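/- There are universal constants $C>0$ and $c>0$ such that the following holds for all integers $n\ge d\ge 1$ and every real $\tau$ with \[ \frac{C\,d\ln(n/d)}{n}\;\le\;\tau\;\le\;\frac1C . \] There are a finite input domain $\mathcal X$ and a set $\mathcal H$ of hypotheses $h:\mathcal X\to\{-1,1\}$ of VC-dimension $d$ such that for every proper learning algorithm $\mathcal A$ (a map that assigns to every sample $S\in(\mathcal X\times\{-1,1\})^n$ a hypothesis $h_S\in\mathcal H$) there is a probability distribution $\mathcal D$ over $\mathcal X\times\{-1,1\}$ for which, writing $\mathrm{er}_{\mathcal D}(h)=\Pr_{(x,y)\sim\mathcal D}[h(x)\ne y]$: 1. the best hypothesis in $\mathcal H$ has error exactly $\tau$, that is, $\min_{h\in\mathcal H}\mathrm{er}_{\mathcal D}(h)=\tau$, and the minimum is attained; 2. with probability at least $1/16$ over a sample $S\sim\mathcal D^n$ of $n$ independent examples, the hypothesis $h_S$ that $\mathcal A$ outputs on $S$ satisfies \[ \mathrm{er}_{\mathcal D}(h_S)\;\ge\;\tau+c\sqrt{\frac{\tau\,d\,\ln(1/\tau)}{n}} , \] with the convention $0\ln(1/0)=0$. -/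

import Mathlib

open MeasureTheory

/-- The two labels `-1` and `1`: the units of `ℤ`. -/
abbrev Label : Type := ℤˣ

/-- Every set of labels is measurable. -/
instance instDiscreteMeasurableSpaceLabel : DiscreteMeasurableSpace Label where
  forall_measurableSet s :=
    ⟨Units.val '' s, MeasurableSet.of_discrete, Set.preimage_image_eq s Units.val_injective⟩

/-- A labelled example `(x, y)`. -/
abbrev Example (X : Type) : Type := X × Label

/-- A hypothesis (classifier) over the input domain `X`. -/
abbrev Hypothesis (X : Type) : Type := X → Label

/-- `H` shatters `s` if every labelling of the points of `s` is produced by some `h ∈ H`. -/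
def HypShatters {X : Type} (H : Set (Hypothesis X)) (s : Finset X) : Prop :=
  ∀ g : X → Label, ∃ h ∈ H, ∀ x ∈ s, h x = g x

/-- `H` has VC-dimension `d`: `d` is the largest number of points shattered by `H`. -/
def HasVCDim {X : Type} (H : Set (Hypothesis X)) (d : ℕ) : Prop :=
  IsGreatest {k : ℕ | ∃ s : Finset X, s.card = k ∧ HypShatters H s} d

/-- The error `er_D(h) = Pr_{(x, y) ∼ D}[h(x) ≠ y]`. -/
noncomputable def er {X : Type} [MeasurableSpace X] (D : Measure (Example X))
    (h : Hypothesis X) : ℝ :=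
  D.real {p | h p.1 ≠ p.2}

/-- The law of a sample of `n` i.i.d. examples from `D`. -/
noncomputable def sampleLaw {X : Type} [MeasurableSpace X] (n : ℕ) (D : Measure (Example X)) :
    Measure (Fin n → Example X) :=
  Measure.pi fun _ => D

/-- A (deterministic) learning algorithm run on `n` examples: it maps each sample to a
hypothesis. -/
abbrev Learner (X : Type) (n : ℕ) : Type := (Fin n → Example X) → Hypothesis X

/-- A learner is proper for `H` if it always outputs a member of `H`. -/
def Learner.IsProper {X : Type} {n : ℕ} (A : Learner X n) (H : Set (Hypothesis X)) : Prop :=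
  ∀ S, A S ∈ H

/-! All labels are `-1`, yet a proper learner must answer `1` at exactly one point of each of `d`
blocks of `K` points, so its error is the total weight of the points it selects. In each block one
hidden point `T b` is lighter than uniform by the factor `1 - β`. The best hypothesis selects these
points, with error `m * (1 - β) / K`, and every missed block costs `m * β / (d * (K - 1))` more.

Finding the light point of a block is a `K`-ary testing problem. Relative to the law that is uniform
on that block, the likelihood ratio of `n` examples has second moment at most `exp (n * β ^ 2 / (d *
(K - 1)))`, which is at most `√K` when `n * β ^ 2 ≤ d * (K - 1) / 2 * log K`. Then `sum_correct_le`
bounds the average success probability by `1 / 4` (`sum_block_correct_le`). Averaging over all `T`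
(`sum_update_eq`) gives one `T` with at most `d / 4` correct blocks in expectation, and by Markov
half the blocks are missed with probability at least `1 / 2`.

With `K ≈ 1 / (2τ)` and `β ≈ √(d log(1/τ) / (nτ))`, the excess is of order `τ * β`, the claimed
rate. -/

open Finset in
/-- A second-moment bound for testing among `t ∈ κ`, the alternative `t` having likelihood ratio `ℓ t`
with respect to the reference weights `q`. -/
theorem sum_correct_le {Ω κ : Type} [Fintype Ω] [Fintype κ] [DecidableEq κ] (n : ℕ)
    (q : Ω → ℝ) (ℓ : κ → Ω → ℝ) (hq : ∀ x, 0 ≤ q x) (hq1 : ∑ x, q x = 1) (V : ℝ)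
    (hV : ∀ t, (∑ x, q x * ℓ t x ^ 2) ^ n ≤ V) (f : (Fin n → Ω) → κ) (l : ℝ) (hl : 0 < l) :
    ∑ t, ∑ S : Fin n → Ω, (if f S = t then ∏ i, (q (S i) * ℓ t (S i)) else 0)
      ≤ Fintype.card κ * V / (2 * l) + l / 2 := by
  have pw (t : κ) (S : Fin n → Ω) : (if f S = t then ∏ i, (q (S i) * ℓ t (S i)) else 0)
      ≤ (∏ i, (q (S i) * ℓ t (S i) ^ 2)) / (2 * l) +
        (if f S = t then l / 2 * ∏ i, q (S i) else 0) := by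
    have hQ : 0 ≤ ∏ i, q (S i) := prod_nonneg fun i _ => hq _
    simp only [prod_mul_distrib, prod_pow]
    set Q := ∏ i, q (S i)
    set L := ∏ i, ℓ t (S i)
    split_ifs
    -- AM-GM in the form `L ≤ L ^ 2 / (2 * l) + l / 2`.
    · have : Q * L ^ 2 / (2 * l) + l / 2 * Q - Q * L = Q * (L - l) ^ 2 / (2 * l) := by
        field_simp; ring
      have : 0 ≤ Q * (L - l) ^ 2 / (2 * l) := by positivity
      linarith
    · positivity
  have tot : ∑ S : Fin n → Ω, ∏ i, q (S i) = 1 := by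
    rw [← Fintype.sum_pow, hq1, one_pow]
  calc _ ≤ ∑ t, ∑ S : Fin n → Ω, ((∏ i, (q (S i) * ℓ t (S i) ^ 2)) / (2 * l) +
        (if f S = t then l / 2 * ∏ i, q (S i) else 0)) :=
        sum_le_sum fun t _ => sum_le_sum fun S _ => pw t S
    _ = (∑ t, (∑ x, q x * ℓ t x ^ 2) ^ n) / (2 * l) + l / 2 := by
        simp only [sum_add_distrib]
        congr 1
        · simp only [← sum_div, Fintype.sum_pow]
        -- Each sample `S` is charged for the single index `t = f S`, so the linear terms add up to
        -- `l / 2`, with no factor `card κ`.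
        · rw [sum_comm]
          simp only [sum_ite_eq, mem_univ, if_true, ← mul_sum, tot, mul_one]
    _ ≤ _ := by
        gcongr
        calc _ ≤ ∑ _t : κ, V := sum_le_sum fun t _ => hV t
          _ = _ := by simp

/-! ### Distributions carried by the label `-1` -/

section Negative

variable {X : Type} [Fintype X] [MeasurableSpace X]

/-- The law of `(x, -1)` when `x` has weight `w x`. -/
noncomputable def negMeasure (w : X → ℝ) : Measure (Example X) :=
  ∑ x, ENNReal.ofReal (w x) • Measure.dirac (x, (-1 : Label))

theorem isProbabilityMeasure_negMeasure (w : X → ℝ) (hw : ∀ x, 0 ≤ w x) (h1 : ∑ x, w x = 1) :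
    IsProbabilityMeasure (negMeasure w) := by
  refine ⟨?_⟩
  rw [negMeasure, Measure.finsetSum_apply]
  simp only [Measure.smul_apply, measure_univ, smul_eq_mul, mul_one]
  rw [← ENNReal.ofReal_sum_of_nonneg fun x _ => hw x, h1, ENNReal.ofReal_one]

variable [DiscreteMeasurableSpace X]

open Classical in
theorem negMeasure_real (w : X → ℝ) (hw : ∀ x, 0 ≤ w x) (s : Set (Example X)) :
    (negMeasure w).real s = ∑ x, if (x, (-1 : Label)) ∈ s then w x else 0 := by
  have hs : MeasurableSet s := s.toFinite.measurableSet
  rw [Measure.real, negMeasure, Measure.finsetSum_apply, ENNReal.toReal_sum]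
  · refine Finset.sum_congr rfl fun x _ => ?_
    rw [Measure.smul_apply, Measure.dirac_apply' _ hs]
    by_cases h : (x, (-1 : Label)) ∈ s <;> simp [h, hw x]
  · intro x _
    rw [Measure.smul_apply, Measure.dirac_apply' _ hs]
    by_cases h : (x, (-1 : Label)) ∈ s <;> simp [h]

theorem er_negMeasure (w : X → ℝ) (hw : ∀ x, 0 ≤ w x) (h : Hypothesis X) :
    er (negMeasure w) h = ∑ x, if h x = -1 then 0 else w x := by
  classical
  rw [er, negMeasure_real w hw]
  refine Finset.sum_congr rfl fun x _ => ?_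
  by_cases hx : h x = -1 <;> simp [hx]

theorem negMeasure_real_singleton (w : X → ℝ) (hw : ∀ x, 0 ≤ w x) (e : Example X) :
    (negMeasure w).real {e} = if e.2 = -1 then w e.1 else 0 := by
  classical
  rw [negMeasure_real w hw]
  obtain ⟨x, y⟩ := e
  by_cases h : y = -1
  · simp [h]
  · simp [h, Ne.symm h]

open Classical in
theorem sampleLaw_real (n : ℕ) (D : Measure (Example X)) [IsProbabilityMeasure D]
    (s : Set (Fin n → Example X)) :
    (sampleLaw n D).real s = ∑ S, if S ∈ s then ∏ i, D.real {S i} else 0 := by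
  have : IsProbabilityMeasure (sampleLaw n D) := by unfold sampleLaw; infer_instance
  have hs : s = ↑(Finset.univ.filter (· ∈ s)) := by ext; simp
  conv_lhs => rw [hs]
  rw [← sum_measureReal_singleton, Finset.sum_filter]
  refine Finset.sum_congr rfl fun S _ => ?_
  congr 1
  simp [sampleLaw, Measure.real, Measure.pi_singleton, ENNReal.toReal_prod]

end Negative

/-! ### The block construction and its lower bound -/

section Blocks

variable {d K : ℕ}

/-- The hypothesis that is `1` exactly at the points `T b` of the blocks `b`. -/
def selector (T : Fin d → Fin K) : Hypothesis (Option (Fin d × Fin K))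
  | none => -1
  | some (b, k) => if k = T b then 1 else -1

/-- Two points per block suffice to label one of them freely, which shatters `d` points. Conversely,
the all-`1` labelling forces a shattered set into the positive set of one selector, which has `d`
points. -/
theorem hasVCDim_selector (hK : 2 ≤ K) :
    HasVCDim (Set.range (selector (d := d) (K := K))) d := by
  constructor
  · let z : Fin K := ⟨0, by omega⟩
    let o : Fin K := ⟨1, by omega⟩
    refine ⟨Finset.univ.image fun b : Fin d => some (b, z), ?_, ?_⟩
    · rw [Finset.card_image_of_injective _ fun a b h => by simpa using h]
      simp
    · intro g
      refine ⟨_, ⟨fun b => if g (some (b, z)) = 1 then z else o, rfl⟩, ?_⟩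
      intro x hx
      obtain ⟨b, -, rfl⟩ := Finset.mem_image.1 hx
      rcases Int.units_eq_one_or (g (some (b, z))) with h | h
      · simp [selector, h]
      · simp [selector, h, z, o]
  · rintro k ⟨s, rfl, hs⟩
    obtain ⟨_, ⟨T, rfl⟩, hT⟩ := hs fun _ => 1
    have : s ⊆ Finset.univ.image fun b : Fin d => some (b, T b) := by
      intro x hx
      have := hT x hx
      rcases x with _ | ⟨b, k⟩
      · simp [selector] at this
      · have hk : k = T b := by
          by_contra hne
          simp [selector, hne] at this
        simp [hk]
    exact (Finset.card_le_card this).trans (Finset.card_image_le.trans (by simp))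

/-- The tilt of the uniform law on a block that makes `t` light. -/
noncomputable def tilt (β : ℝ) (t k : Fin K) : ℝ := if k = t then 1 - β else 1 + β / (K - 1)

/-- Total weight `m` spread evenly over the blocks, tilted at `T b` in the block `b`. -/
noncomputable def weight (m β : ℝ) (T : Fin d → Fin K) : Option (Fin d × Fin K) → ℝ
  | none => 1 - m
  | some (b, k) => m / (d * K) * tilt β (T b) k

/-- As `weight`, but uniform on the block `b₀`. -/
noncomputable def refWeight (m β : ℝ) (T : Fin d → Fin K) (b₀ : Fin d) :
    Option (Fin d × Fin K) → ℝ
  | none => 1 - m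
  | some (b, k) => m / (d * K) * if b = b₀ then 1 else tilt β (T b) k

/-- The likelihood ratio of a weight with respect to `refWeight` at `b₀`. -/
noncomputable def blockRatio (β : ℝ) (b₀ : Fin d) (t : Fin K) : Option (Fin d × Fin K) → ℝ
  | none => 1
  | some (b, k) => if b = b₀ then tilt β t k else 1

/-- `refWeight` does not depend on `T b₀`, so it is a common reference for all `K` candidates `t`.
-/
theorem weight_update (m β : ℝ) (T : Fin d → Fin K) (b₀ : Fin d) (t : Fin K)
    (x : Option (Fin d × Fin K)) :
    weight m β (Function.update T b₀ t) x = refWeight m β T b₀ x * blockRatio β b₀ t x := by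
  rcases x with _ | ⟨b, k⟩
  · simp [weight, refWeight, blockRatio]
  · by_cases h : b = b₀
    · subst h; simp [weight, refWeight, blockRatio]
    · simp [weight, refWeight, blockRatio, h]

theorem sum_ite_eq_const (t : Fin K) (a b : ℝ) :
    ∑ k, (if k = t then a else b) = a + (K - 1) * b := by
  have : ∀ k : Fin K, (if k = t then a else b) = (if k = t then a - b else 0) + b := by
    intro k; split_ifs <;> ring
  simp only [this, Finset.sum_add_distrib, Finset.sum_ite_eq', Finset.mem_univ, if_true,
    Finset.sum_const, Finset.card_univ, Fintype.card_fin, nsmul_eq_mul]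
  ring

theorem sum_tilt (hK : 2 ≤ K) (β : ℝ) (t : Fin K) : ∑ k, tilt β t k = K := by
  have : (K : ℝ) - 1 ≠ 0 := by
    have : (2 : ℝ) ≤ K := by exact_mod_cast hK
    linarith
  simp only [tilt, sum_ite_eq_const]
  field_simp; ring

theorem sum_tilt_sq (hK : 2 ≤ K) (β : ℝ) (t : Fin K) :
    ∑ k, tilt β t k ^ 2 = K + K * β ^ 2 / (K - 1) := by
  have : (K : ℝ) - 1 ≠ 0 := by
    have : (2 : ℝ) ≤ K := by exact_mod_cast hK
    linarith
  simp only [tilt, ite_pow, sum_ite_eq_const]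
  field_simp; ring

theorem tilt_nonneg (hK : 2 ≤ K) {β : ℝ} (h0 : 0 ≤ β) (h1 : β ≤ 1) (t k : Fin K) :
    0 ≤ tilt β t k := by
  have : (2 : ℝ) ≤ K := by exact_mod_cast hK
  have : 0 ≤ β / ((K : ℝ) - 1) := div_nonneg h0 (by linarith)
  unfold tilt; split_ifs <;> linarith

theorem weight_nonneg (hK : 2 ≤ K) {m β : ℝ} (hm0 : 0 ≤ m) (hm1 : m ≤ 1) (h0 : 0 ≤ β)
    (h1 : β ≤ 1) (T : Fin d → Fin K) (x) : 0 ≤ weight m β T x := by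
  rcases x with _ | ⟨b, k⟩
  · simpa [weight] using hm1
  · exact mul_nonneg (by positivity) (tilt_nonneg hK h0 h1 _ _)

theorem refWeight_nonneg (hK : 2 ≤ K) {m β : ℝ} (hm0 : 0 ≤ m) (hm1 : m ≤ 1) (h0 : 0 ≤ β)
    (h1 : β ≤ 1) (T : Fin d → Fin K) (b₀ x) : 0 ≤ refWeight m β T b₀ x := by
  rcases x with _ | ⟨b, k⟩
  · simpa [refWeight] using hm1
  · refine mul_nonneg (by positivity) ?_
    split_ifs
    · exact zero_le_one
    · exact tilt_nonneg hK h0 h1 _ _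

theorem sum_weight (hd : 1 ≤ d) (hK : 2 ≤ K) (m β : ℝ) (T : Fin d → Fin K) :
    ∑ x, weight m β T x = 1 := by
  have hd' : (d : ℝ) ≠ 0 := by positivity
  have hK' : (K : ℝ) ≠ 0 := by positivity
  simp only [Fintype.sum_option, Fintype.sum_prod_type, weight, ← Finset.mul_sum, sum_tilt hK,
    Finset.sum_const, Finset.card_univ, Fintype.card_fin, nsmul_eq_mul]
  field_simp; ring

theorem sum_refWeight (hd : 1 ≤ d) (hK : 2 ≤ K) (m β : ℝ) (T : Fin d → Fin K) (b₀ : Fin d) :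
    ∑ x, refWeight m β T b₀ x = 1 := by
  have hd' : (d : ℝ) ≠ 0 := by positivity
  have hK' : (K : ℝ) ≠ 0 := by positivity
  have (b : Fin d) : ∑ k, (if b = b₀ then 1 else tilt β (T b) k) = (K : ℝ) := by
    split_ifs
    · simp
    · exact sum_tilt hK _ _
  simp only [Fintype.sum_option, Fintype.sum_prod_type, refWeight, ← Finset.mul_sum, this,
    Finset.sum_const, Finset.card_univ, Fintype.card_fin, nsmul_eq_mul]
  field_simp; ring

/-- Only the block `b₀`, of mass `m / d`, contributes to the chi-square divergence; this is the
source of the factor `d` in the rate. -/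
theorem sum_refWeight_mul_sq (hd : 1 ≤ d) (hK : 2 ≤ K) (m β : ℝ) (T : Fin d → Fin K)
    (b₀ : Fin d) (t : Fin K) :
    ∑ x, refWeight m β T b₀ x * blockRatio β b₀ t x ^ 2 = 1 + m * β ^ 2 / (d * (K - 1)) := by
  have hd' : (d : ℝ) ≠ 0 := by positivity
  have hK' : (K : ℝ) ≠ 0 := by positivity
  have hK1 : (K : ℝ) - 1 ≠ 0 := by
    have : (2 : ℝ) ≤ K := by exact_mod_cast hK
    linarith
  have (b : Fin d) : ∑ k, (m / (d * K) * (if b = b₀ then 1 else tilt β (T b) k)) *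
      (if b = b₀ then tilt β t k else 1) ^ 2
      = (if b = b₀ then m * β ^ 2 / (d * (K - 1)) else 0) + m / d := by
    split_ifs
    · simp only [mul_one, ← Finset.mul_sum, sum_tilt_sq hK]
      field_simp; ring
    · simp only [one_pow, mul_one, ← Finset.mul_sum, sum_tilt hK]
      field_simp; ring
  simp only [Fintype.sum_option, Fintype.sum_prod_type, refWeight, blockRatio, this,
    Finset.sum_add_distrib, Finset.sum_ite_eq', Finset.mem_univ, if_true,
    Finset.sum_const, Finset.card_univ, Fintype.card_fin, nsmul_eq_mul]
  field_simp; ring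

theorem er_selector (hK : 2 ≤ K) {m β : ℝ} (hm0 : 0 ≤ m) (hm1 : m ≤ 1) (h0 : 0 ≤ β)
    (h1 : β ≤ 1) [MeasurableSpace (Option (Fin d × Fin K))]
    [DiscreteMeasurableSpace (Option (Fin d × Fin K))] (T U : Fin d → Fin K) :
    er (negMeasure (weight m β T)) (selector U) = ∑ b, m / (d * K) * tilt β (T b) (U b) := by
  rw [er_negMeasure _ (weight_nonneg hK hm0 hm1 h0 h1 T)]
  have h (b : Fin d) (k : Fin K) : (if selector U (some (b, k)) = -1 then 0
      else weight m β T (some (b, k))) = if k = U b then m / (d * K) * tilt β (T b) k else 0 := by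
    by_cases h : k = U b <;> simp [selector, weight, h]
  simp only [Fintype.sum_option, Fintype.sum_prod_type, h]
  simp [selector]

/-- Averaged over the light point of one block, an estimator finds it with probability at most
`1 / 4`. -/
theorem sum_block_correct_le {n : ℕ} (hd : 1 ≤ d) (hK : 256 ≤ K) {m β : ℝ} (hm0 : 0 ≤ m)
    (hm1 : m ≤ 1) (h0 : 0 ≤ β) (h1 : β ≤ 1)
    (hn : n * β ^ 2 ≤ d * (K - 1) / 2 * Real.log K) (T : Fin d → Fin K) (b₀ : Fin d)
    (f : (Fin n → Example (Option (Fin d × Fin K))) → Fin K) :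
    ∑ t, ∑ S : Fin n → Example (Option (Fin d × Fin K)),
      (if f S = t then ∏ i, (if (S i).2 = -1
        then weight m β (Function.update T b₀ t) (S i).1 else 0) else 0) ≤ (K : ℝ) / 4 := by
  have hK2 : 2 ≤ K := by omega
  have hKr : (256 : ℝ) ≤ K := by exact_mod_cast hK
  have hdr : (1 : ℝ) ≤ d := by exact_mod_cast hd
  have hlab (g : Option (Fin d × Fin K) → ℝ) :
      ∑ e : Example (Option (Fin d × Fin K)), (if e.2 = -1 then g e.1 else 0) = ∑ x, g x := by
    simp [Fintype.sum_prod_type]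
  -- The second moment is at most `√K` by `hn` and `m ≤ 1`. With `l = K / 4` the bound reads `2 * √K
  -- + K / 8`, which is at most `K / 4` exactly when `√K ≥ 16`; hence `K ≥ 256`.
  have key := sum_correct_le n
    (fun e : Example (Option (Fin d × Fin K)) => if e.2 = -1 then refWeight m β T b₀ e.1 else 0)
    (fun t e => blockRatio β b₀ t e.1)
    (fun e => by
      split_ifs
      · exact refWeight_nonneg hK2 hm0 hm1 h0 h1 _ _ _
      · exact le_rfl)
    (by rw [hlab, sum_refWeight hd hK2]) (√K)
    (fun t => by
      have : ∑ e : Example (Option (Fin d × Fin K)),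
          (if e.2 = -1 then refWeight m β T b₀ e.1 else 0) * blockRatio β b₀ t e.1 ^ 2
          = 1 + m * β ^ 2 / (d * (K - 1)) := by
        simp only [ite_mul, zero_mul]
        rw [hlab fun x => refWeight m β T b₀ x * blockRatio β b₀ t x ^ 2,
          sum_refWeight_mul_sq hd hK2]
      rw [this]
      have hpos : 0 < (d : ℝ) * (K - 1) := by nlinarith
      have hx : 0 ≤ m * β ^ 2 / (d * ((K : ℝ) - 1)) := by positivity
      calc (1 + m * β ^ 2 / (d * ((K : ℝ) - 1))) ^ n
          ≤ Real.exp (m * β ^ 2 / (d * ((K : ℝ) - 1))) ^ n := by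
            gcongr
            linarith [Real.add_one_le_exp (m * β ^ 2 / (d * ((K : ℝ) - 1)))]
        _ = Real.exp (n * (m * β ^ 2 / (d * ((K : ℝ) - 1)))) := by rw [← Real.exp_nat_mul]
        _ ≤ Real.exp (Real.log K / 2) := by
            gcongr
            rw [mul_div_assoc', div_le_iff₀ hpos]
            have : (n : ℝ) * (m * β ^ 2) ≤ n * β ^ 2 := by
              gcongr
              nlinarith [sq_nonneg β]
            linarith
        _ = √K := by
            rw [← Real.log_sqrt (by positivity), Real.exp_log (by positivity)])
    f ((K : ℝ) / 4) (by positivity)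
  have hs : 16 ≤ √(K : ℝ) := by
    rw [Real.le_sqrt (by norm_num) (by positivity)]; linarith
  have hsq : √(K : ℝ) * √K = K := Real.mul_self_sqrt (by positivity)
  calc _ = _ := by
        refine Finset.sum_congr rfl fun t _ => Finset.sum_congr rfl fun S _ => ?_
        congr 1
        refine Finset.prod_congr rfl fun i _ => ?_
        rw [weight_update, ite_mul, zero_mul]
    _ ≤ _ := key
    _ = 2 * √K + K / 8 := by
        rw [Fintype.card_fin]
        field_simp; ring
    _ ≤ _ := by nlinarith

/-- Resampling one coordinate preserves the uniform law on `T`: each tuple arises from `K` pairs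
`(T, t)`. This carries the one-block bound over to the average over all `T`. -/
theorem sum_update_eq (b₀ : Fin d) (F : (Fin d → Fin K) → ℝ) :
    ∑ T, ∑ t, F (Function.update T b₀ t) = K * ∑ T, F T := by
  have h (G : (Fin d → Fin K) → ℝ) : ∑ T, G T =
      ∑ x : Fin K × ({j // j ≠ b₀} → Fin K), G ((Equiv.funSplitAt b₀ (Fin K)).symm x) :=
    ((Equiv.funSplitAt b₀ (Fin K)).symm.sum_comp G).symm
  have hu (s t : Fin K) (u : {j // j ≠ b₀} → Fin K) :
      Function.update ((Equiv.funSplitAt b₀ (Fin K)).symm (s, u)) b₀ t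
        = (Equiv.funSplitAt b₀ (Fin K)).symm (t, u) := by
    ext j
    by_cases hj : j = b₀
    · subst hj; simp [Equiv.funSplitAt, Equiv.piSplitAt]
    · simp [Equiv.funSplitAt, Equiv.piSplitAt, hj]
  rw [h, h F]
  simp only [Fintype.sum_prod_type, hu, Finset.sum_const, Finset.card_univ, Fintype.card_fin,
    nsmul_eq_mul]
  rw [Finset.sum_comm]

/-- The lower bound in terms of the parameters of the construction. -/
theorem exists_hard_class {n : ℕ} (hd : 1 ≤ d) (hK : 256 ≤ K) {m β : ℝ} (hm0 : 0 ≤ m)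
    (hm1 : m ≤ 1) (h0 : 0 ≤ β) (h1 : β ≤ 1)
    (hn : n * β ^ 2 ≤ d * (K - 1) / 2 * Real.log K) :
    ∃ (X : Type) (_ : Finite X) (_ : MeasurableSpace X) (_ : DiscreteMeasurableSpace X)
      (H : Set (Hypothesis X)), HasVCDim H d ∧
        ∀ A : Learner X n, A.IsProper H →
          ∃ D : Measure (Example X), IsProbabilityMeasure D ∧
            IsLeast (er D '' H) (m * (1 - β) / K) ∧
            1 / 16 ≤ (sampleLaw n D).real
              {S | m * (1 - β) / K + m * β / (2 * (K - 1)) ≤ er D (A S)} := by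
  have hK2 : 2 ≤ K := by omega
  have hKr : (256 : ℝ) ≤ K := by exact_mod_cast hK
  have hdr : (1 : ℝ) ≤ d := by exact_mod_cast hd
  have hdK : 0 ≤ m / (d * K) := by positivity
  let : MeasurableSpace (Option (Fin d × Fin K)) := ⊤
  have : DiscreteMeasurableSpace (Option (Fin d × Fin K)) := ⟨fun _ => trivial⟩
  refine ⟨Option (Fin d × Fin K), inferInstance, inferInstance, inferInstance,
    Set.range selector, hasVCDim_selector hK2, fun A hA => ?_⟩
  choose U hU using hA
  let P (T : Fin d → Fin K) (S : Fin n → Example (Option (Fin d × Fin K))) : ℝ :=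
    ∏ i, (if (S i).2 = -1 then weight m β T (S i).1 else 0)
  have hP0 (T S) : 0 ≤ P T S := Finset.prod_nonneg fun i _ => by
    split_ifs
    · exact weight_nonneg hK2 hm0 hm1 h0 h1 _ _
    · exact le_rfl
  have hP1 (T) : ∑ S, P T S = 1 := by
    simp only [P]
    rw [← Fintype.sum_pow (f := fun e : Example (Option (Fin d × Fin K)) =>
      if e.2 = -1 then weight m β T e.1 else 0)]
    simp [Fintype.sum_prod_type, sum_weight hd hK2]
  have hblock (b : Fin d) :
      ∑ T, ∑ S, (if U S b = T b then P T S else 0) ≤ (K : ℝ) ^ d / 4 := by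
    have e := sum_update_eq b fun T => ∑ S, (if U S b = T b then P T S else 0)
    have : ∑ T, ∑ t, (∑ S, (if U S b = Function.update T b t b then
        P (Function.update T b t) S else 0)) ≤ ∑ _T : Fin d → Fin K, (K : ℝ) / 4 := by
      refine Finset.sum_le_sum fun T _ => ?_
      simp only [Function.update_self]
      exact sum_block_correct_le hd hK hm0 hm1 h0 h1 hn T b fun S => U S b
    rw [e] at this
    simp only [Finset.sum_const, Finset.card_univ, Fintype.card_pi, Fintype.card_fin,
      Finset.prod_const, nsmul_eq_mul, Nat.cast_pow] at this
    have hKpos : (0 : ℝ) < K := by positivity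
    refine le_of_mul_le_mul_left (this.trans_eq ?_) hKpos
    ring
  let N (T : Fin d → Fin K) (S : Fin n → Example (Option (Fin d × Fin K))) : ℝ :=
    ∑ b, if U S b = T b then 1 else 0
  -- Were every `T` to violate this, the sum over the `K ^ d` tuples would exceed the total of the
  -- block bounds.
  obtain ⟨T, hT⟩ : ∃ T, ∑ S, N T S * P T S ≤ d / 4 := by
    by_contra! hcon
    have hne : (Finset.univ : Finset (Fin d → Fin K)).Nonempty :=
      ⟨fun _ => ⟨0, by omega⟩, Finset.mem_univ _⟩
    have lt := Finset.sum_lt_sum_of_nonempty hne fun T _ => hcon T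
    have le : ∑ T, ∑ S, N T S * P T S ≤ ∑ _b : Fin d, (K : ℝ) ^ d / 4 := by
      calc ∑ T, ∑ S, N T S * P T S = ∑ b, ∑ T, ∑ S, (if U S b = T b then P T S else 0) := by
            symm
            rw [Finset.sum_comm]
            refine Finset.sum_congr rfl fun T _ => ?_
            rw [Finset.sum_comm]
            refine Finset.sum_congr rfl fun S _ => ?_
            simp only [N, Finset.sum_mul, ite_mul, one_mul, zero_mul]
        _ ≤ _ := Finset.sum_le_sum fun b _ => hblock b
    simp only [Finset.sum_const, Finset.card_univ, Fintype.card_pi, Fintype.card_fin,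
      Finset.prod_const, nsmul_eq_mul, Nat.cast_pow] at lt le
    nlinarith
  have hw := weight_nonneg hK2 hm0 hm1 h0 h1 T
  have hprob := isProbabilityMeasure_negMeasure _ hw (sum_weight hd hK2 m β T)
  have hself : er (negMeasure (weight m β T)) (selector T) = m * (1 - β) / K := by
    rw [er_selector hK2 hm0 hm1 h0 h1]
    simp only [tilt, if_true, Finset.sum_const, Finset.card_univ, Fintype.card_fin, nsmul_eq_mul]
    field_simp
  have hdiff (V : Fin d → Fin K) : er (negMeasure (weight m β T)) (selector V)
      = m * (1 - β) / K +
        (d - ∑ b, if V b = T b then 1 else 0) * (m * β / (d * (K - 1))) := by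
    have hK1 : (K : ℝ) - 1 ≠ 0 := by linarith
    rw [er_selector hK2 hm0 hm1 h0 h1]
    have (b : Fin d) : m / (d * K) * tilt β (T b) (V b) = m * (1 - β) / (d * K) +
        (1 - if V b = T b then 1 else 0) * (m * β / (d * (K - 1))) := by
      unfold tilt
      split_ifs <;> field_simp <;> ring
    simp only [this, Finset.sum_add_distrib, ← Finset.sum_mul, Finset.sum_sub_distrib,
      Finset.sum_const, Finset.card_univ, Fintype.card_fin, nsmul_eq_mul, mul_one]
    congr 1
    field_simp
  have hgap : 0 ≤ m * β / (d * ((K : ℝ) - 1)) :=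
    div_nonneg (by positivity) (mul_nonneg (by positivity) (by linarith))
  refine ⟨negMeasure (weight m β T), hprob, ⟨⟨selector T, ⟨T, rfl⟩, hself⟩, ?_⟩, ?_⟩
  · rintro _ ⟨_, ⟨V, rfl⟩, rfl⟩
    rw [hdiff V]
    have : ∑ b, (if V b = T b then (1 : ℝ) else 0) ≤ ∑ _b : Fin d, (1 : ℝ) :=
      Finset.sum_le_sum fun b _ => by split_ifs <;> norm_num
    simp only [Finset.sum_const, Finset.card_univ, Fintype.card_fin, nsmul_eq_mul, mul_one] at this
    have := mul_nonneg (sub_nonneg.2 this) hgap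
    linarith
  · classical
    rw [sampleLaw_real]
    simp only [negMeasure_real_singleton _ hw]
    -- Markov's inequality pointwise: outside the event more than `d / 2` blocks are correct, so the
    -- left side is nonpositive. Summing over `S` gives `1 - 2 / d * (d / 4) = 1 / 2`.
    have pw (S) : P T S - 2 / d * (N T S * P T S) ≤
        if S ∈ {S | m * (1 - β) / K + m * β / (2 * (K - 1)) ≤
          er (negMeasure (weight m β T)) (A S)} then P T S else 0 := by
      have hN : 0 ≤ N T S := Finset.sum_nonneg fun b _ => by split_ifs <;> norm_num
      split_ifs with h
      · have := hP0 T S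
        have : 0 ≤ 2 / d * (N T S * P T S) := by positivity
        linarith
      · have hlt : (d : ℝ) / 2 < N T S := by
          by_contra! hle
          apply h
          rw [Set.mem_ofPred_eq, ← hU S, hdiff]
          have := mul_le_mul_of_nonneg_right
            (show (d : ℝ) / 2 ≤ d - N T S by linarith) hgap
          have e : (d : ℝ) / 2 * (m * β / (d * ((K : ℝ) - 1))) = m * β / (2 * (K - 1)) := by
            have hK1 : (K : ℝ) - 1 ≠ 0 := by linarith
            field_simp
          rw [e] at this
          exact add_le_add le_rfl this
        have h2 : 1 ≤ 2 / d * N T S := by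
          rw [div_mul_eq_mul_div, le_div_iff₀ (by positivity)]
          linarith
        have := mul_le_mul_of_nonneg_right h2 (hP0 T S)
        linarith
    have tot := Finset.sum_le_sum fun S (_ : S ∈ Finset.univ) => pw S
    rw [Finset.sum_sub_distrib, hP1, ← Finset.mul_sum] at tot
    have : 2 / (d : ℝ) * ∑ S, N T S * P T S ≤ 2 / d * (d / 4) := by gcongr
    have e : 2 / (d : ℝ) * (d / 4) = 1 / 2 := by field_simp; norm_num
    refine le_trans ?_ tot
    linarith

end Blocks

/-! ### Choice of parameters -/

theorem mul_log_inv_le_one {τ : ℝ} (h0 : 0 ≤ τ) : τ * Real.log (1 / τ) ≤ 1 := by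
  rcases h0.eq_or_lt with rfl | h
  · simp
  · have := Real.log_le_sub_one_of_pos (show 0 < 1 / τ by positivity)
    calc τ * Real.log (1 / τ) ≤ τ * (1 / τ - 1) := by gcongr
      _ = 1 - τ := by field_simp
      _ ≤ 1 := by linarith

theorem theorem2 :
    ∃ C : ℝ, 0 < C ∧ ∃ c : ℝ, 0 < c ∧
      ∀ (d n : ℕ) (τ : ℝ), 1 ≤ d → d ≤ n →
        C * d * Real.log (n / d) / n ≤ τ → τ ≤ 1 / C →
        ∃ (X : Type) (_ : Finite X) (_ : MeasurableSpace X) (_ : DiscreteMeasurableSpace X)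
          (H : Set (Hypothesis X)),
          HasVCDim H d ∧
          ∀ A : Learner X n, A.IsProper H →
            ∃ D : Measure (Example X), IsProbabilityMeasure D ∧
              IsLeast (er D '' H) τ ∧
              1 / 16 ≤ (sampleLaw n D).real
                {S | τ + c * √(τ * d * Real.log (1 / τ) / n) ≤ er D (A S)} := by
  refine ⟨1024, by norm_num, 1 / 2000, by norm_num, fun d n τ hd hdn hτ hτ1 => ?_⟩
  have hdr : (1 : ℝ) ≤ d := by exact_mod_cast hd
  have hdnr : (d : ℝ) ≤ n := by exact_mod_cast hdn
  have hn0 : (0 : ℝ) < n := by linarith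
  have hlog0 : 0 ≤ Real.log (n / d) := Real.log_nonneg (by rwa [one_le_div (by linarith)])
  have hτ0 : 0 ≤ τ := le_trans (by positivity) hτ
  suffices h : ∃ (K : ℕ) (m β : ℝ), 256 ≤ K ∧ 0 ≤ m ∧ m ≤ 1 ∧ 0 ≤ β ∧ β ≤ 1 ∧
      n * β ^ 2 ≤ d * (K - 1) / 2 * Real.log K ∧ m * (1 - β) / K = τ ∧
      1 / 2000 * √(τ * d * Real.log (1 / τ) / n) ≤ m * β / (2 * (K - 1)) by
    obtain ⟨K, m, β, hK, hm0, hm1, h0, h1, hnβ, hτe, hex⟩ := h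
    obtain ⟨X, i₁, i₂, i₃, H, hH, hA⟩ := exists_hard_class hd hK hm0 hm1 h0 h1 hnβ
    refine ⟨X, i₁, i₂, i₃, H, hH, fun A hp => ?_⟩
    obtain ⟨D, hD, hl, hpr⟩ := hA A hp
    rw [hτe] at hl hpr
    refine ⟨D, hD, hl, hpr.trans ?_⟩
    have : IsProbabilityMeasure (sampleLaw n D) := by unfold sampleLaw; infer_instance
    refine measureReal_mono fun S hS => ?_
    rw [Set.mem_ofPred_eq] at hS ⊢
    linarith
  -- For `n ≤ 2 * d` the logarithm `log (n / d)` may vanish and `τ` may be `0`, so `K` cannot be `1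
  -- / (2τ)`. A constant `K` works, since the required excess is then at most a constant; `β` is
  -- fixed by `m * (1 - β) / K = τ` with `m = 1`.
  by_cases hr : (n : ℝ) ≤ 2 * d
  · refine ⟨256, 1, 1 - 256 * τ, le_rfl, zero_le_one, le_rfl, by linarith, by linarith, ?_,
      by norm_num, ?_⟩
    · have hl : 1 ≤ Real.log (256 : ℕ) := by
        rw [Real.le_log_iff_exp_le (by norm_num)]
        have := Real.exp_one_lt_d9
        push_cast; linarith
      have hs : (1 - 256 * τ) ^ 2 ≤ 1 := by nlinarith
      calc (n : ℝ) * (1 - 256 * τ) ^ 2 ≤ n * 1 := by gcongr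
        _ ≤ d * ((256 : ℕ) - 1) / 2 * 1 := by push_cast; linarith
        _ ≤ _ := by
            gcongr
    · have : √(τ * d * Real.log (1 / τ) / n) ≤ 1 := by
        rw [Real.sqrt_le_one, div_le_one hn0]
        have := mul_le_mul_of_nonneg_left (mul_log_inv_le_one hτ0) (show (0 : ℝ) ≤ d by linarith)
        linarith
      push_cast
      rw [le_div_iff₀ (by norm_num)]
      linarith
  · rw [not_le] at hr
    have hlog2 : 1 / 2 < Real.log (n / d) :=
      lt_trans (by linarith [Real.log_two_gt_d9]) (Real.log_lt_log (by norm_num)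
        (show (2 : ℝ) < n / d by rwa [lt_div_iff₀ (by linarith)]))
    rw [div_le_iff₀ hn0] at hτ
    have hτpos : 0 < τ := by
      by_contra! hle
      have : 0 < 1024 * d * Real.log (n / d) := by positivity
      nlinarith
    have hinv : 1024 ≤ 1 / τ := by
      rw [le_div_iff₀ hτpos]; linarith
    set L := Real.log (1 / τ) with hL
    have hLpos : 0 < L := Real.log_pos (by linarith)
    -- The lower bound on `τ` gives `n * τ ≥ 512 * d`, hence `1 / τ ≤ n / d`. The same lower bound
    -- then yields `d * L ≤ n * τ`, which keeps `β` small.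
    have hLle : L ≤ Real.log (n / d) := by
      apply Real.log_le_log (by positivity)
      rw [div_le_div_iff₀ hτpos (by linarith)]
      nlinarith
    set β := 1 / 4 * √(d * L / (n * τ)) with hβ
    have hβ0 : 0 ≤ β := by positivity
    have hβsq : β ^ 2 = d * L / (n * τ) / 16 := by
      rw [hβ, mul_pow, Real.sq_sqrt (by positivity)]; ring
    have hβ2 : β ≤ 1 / 2 := by
      have : d * L / (n * τ) ≤ 1 := by
        rw [div_le_one (by positivity)]
        nlinarith
      have := Real.sqrt_le_one.2 this
      rw [hβ]; linarith
    set K := ⌊1 / (2 * τ)⌋₊ with hKdef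
    have hhalf : 1 / (2 * τ) = 1 / τ / 2 := by field_simp
    have hKle : (K : ℝ) ≤ 1 / (2 * τ) := Nat.floor_le (by positivity)
    have hKgt : 1 / (2 * τ) < K + 1 := Nat.lt_floor_add_one _
    have hK : 256 ≤ K := Nat.le_floor (by push_cast; rw [hhalf]; linarith)
    have hKr : (256 : ℝ) ≤ K := by exact_mod_cast hK
    have hKτ : K * τ ≤ 1 / 2 := by
      calc K * τ ≤ 1 / (2 * τ) * τ := by gcongr
        _ = 1 / 2 := by field_simp
    -- `K` exceeds `1 / (2τ) - 1`, which is at least `√(1 / τ)` because `√(1 / τ) ≥ 32`.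
    have hlogK : L / 2 ≤ Real.log K := by
      rw [hL, ← Real.log_sqrt (by positivity)]
      apply Real.log_le_log (by positivity)
      have h32 : 32 ≤ √(1 / τ) := by
        rw [Real.le_sqrt (by norm_num) (by positivity)]; linarith
      have hss : √(1 / τ) * √(1 / τ) = 1 / τ := Real.mul_self_sqrt (by positivity)
      nlinarith
    -- This mass solves `m * (1 - β) / K = τ`; it fits because `K * τ ≤ 1 / 2 ≤ 1 - β`.
    have hm1 : K * τ / (1 - β) ≤ 1 := by
      rw [div_le_one (by linarith)]; linarith
    refine ⟨K, K * τ / (1 - β), β, hK, div_nonneg (by positivity) (by linarith), hm1, hβ0,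
      by linarith, ?_, ?_, ?_⟩
    · rw [hβsq]
      -- The factor `1 / 4` in `β` is chosen for this step: `n * β ^ 2 = d * L / (16 * τ)` splits
      -- into lower bounds for `K - 1` and for `log K`.
      have h4 : 1 / τ / 4 ≤ (K : ℝ) - 1 := by linarith
      calc (n : ℝ) * (d * L / (n * τ) / 16) = d * (1 / τ / 4) / 2 * (L / 2) := by
            field_simp; ring
        _ ≤ _ := by
            have : 0 ≤ (d : ℝ) * (K - 1) / 2 := by
              have : (0 : ℝ) ≤ K - 1 := by linarith
              positivity
            gcongr
    · have : 1 - β ≠ 0 := by linarith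
      field_simp
    · have hm : K * τ ≤ K * τ / (1 - β) := by
        rw [le_div_iff₀ (by linarith)]
        have : 0 ≤ K * τ := by positivity
        nlinarith
      have hsq : √(τ * d * L / n) = τ * √(d * L / (n * τ)) := by
        rw [show τ * d * L / n = τ ^ 2 * (d * L / (n * τ)) by field_simp,
          Real.sqrt_mul (by positivity), Real.sqrt_sq hτ0]
      have hs0 : 0 ≤ τ * √(d * L / (n * τ)) := by positivity
      calc 1 / 2000 * √(τ * d * L / n) ≤ τ * β / 2 := by
            rw [hsq, hβ]; linarith
        _ ≤ K * τ * β / (2 * (K - 1)) := by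
            rw [div_le_div_iff₀ (by norm_num) (by linarith)]
            have : 0 ≤ τ * β := by positivity
            nlinarith
        _ ≤ _ := by
            gcongr
            linarith
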